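/- \textbf{Calculus.} Let $\mathcal D(O)$ be the set of finite-support probability distributions on $O$ and $\delta_o$ the Dirac distribution. Values are real numbers, Booleans, names, and a dummy value for pure synchronisation. Processes are the closed terms of $$P ::= \mathsf{nil}\mid \mathsf{tick}.C\mid P\parallel P\mid \lfloor chn.C\rfloor D\mid \mathsf{read}\,x\,s.C\mid \mathsf{write}\,v\,a.C\mid \mathsf{if}\,(b)\,\{P\}\,\mathsf{else}\,\{P\}\mid P\backslash c\mid X\mid \mathsf{fix}\,X.P,$$ with $chn ::= \bar c\langle v\rangle \mid c(x)$, where $C,D ::= \bigoplus_{i\in I}p_i{:}P_i$ ($I$ finite and non-empty, $p_i>0$, $\sum_i p_i=1$) denote the distributions $[\![C]\!]=\sum_i p_i\delta_{P_i}$, and $P$ abbreviates $1{:}P$. Recursion is time-guarded (a process variable bound by $\mathsf{fix}$ occurs only inside $C$ of some $\mathsf{tick}.C$ or inside $D$ of some $\lfloor chn.C\rfloor D$), and a conditional is identified with the branch that its guard selects. Parallel composition, restriction and substitution extend to distributions over processes. The process transitions $P\xrightarrow{\lambda}\pi$ are generated by $\lfloor\bar c\langle v\rangle.C\rfloor D\xrightarrow{\bar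 c v}[\![C]\!]$; $\lfloor c(x).C\rfloor D\xrightarrow{c v}[\![C\{v/x\}]\!]$ for all values $v$; $\mathsf{write}\,v\,a.C\xrightarrow{a!v}[\![C]\!]$; $\mathsf{read}\,x\,s.C\xrightarrow{s?x}[\![C]\!]$; $\mathsf{nil}\xrightarrow{\mathsf{tick}}\delta_{\mathsf{nil}}$; $\mathsf{tick}.C\xrightarrow{\mathsf{tick}}[\![C]\!]$; $\lfloor chn.C\rfloor D\xrightarrow{\mathsf{tick}}[\![D]\!]$; interleaving $P\parallel Q\xrightarrow{\lambda}\pi\parallel\delta_Q$ if $P\xrightarrow{\lambda}\pi$, $\lambda\ne\mathsf{tick}$ (and symmetrically); communication $P\parallel Q\xrightarrow{\tau}\pi\parallel\pi'$ if $P\xrightarrow{\bar cv}\pi$, $Q\xrightarrow{cv}\pi'$ (and symmetrically); $P\parallel Q\xrightarrow{\mathsf{tick}}\pi\parallel\pi'$ if $P\xrightarrow{\mathsf{tick}}\pi$, $Q\xrightarrow{\mathsf{tick}}\pi'$ and $P\parallel Q$ has no $\tau$-transition; $P\backslash c\xrightarrow{\lambda}\pi\backslash c$ if $P\xrightarrow{\lambda}\pi$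 and $\lambda$ is not an input or output on $c$; and $\mathsf{fix}\,X.P\xrightarrow{\lambda}\pi$ if $P\{\mathsf{fix}\,X.P/X\}\xrightarrow{\lambda}\pi$. \textbf{Systems.} Over sets $\mathsf X,\mathsf S,\mathsf A$ of state variables, sensors and actuators, a physical state is $\sigma=\langle\xi_x,\xi_s,\xi_a\rangle\in\mathbb R^{\mathsf X}\times\mathbb R^{\mathsf S}\times\mathbb R^{\mathsf A}$, and a physical environment is $E=\langle evol,meas,inv\rangle$ with $evol:\mathbb R^{\mathsf X}\times\mathbb R^{\mathsf A}\to\mathcal D(\mathbb R^{\mathsf X})$, $meas:\mathbb R^{\mathsf X}\to\mathcal D(\mathbb R^{\mathsf S})$, $inv\subseteq\mathbb R^{\mathsf X}$. A cyber-physical system (CPS) is $E;\sigma\bowtie P$, where $P$ uses only sensors in $\mathsf S$ and actuators in $\mathsf A$, or the special system $\mathsf{Dead}$, which has no transitions. Its transitions are as follows. If $\xi_x\notin inv$, the only transition of $E;\sigma\bowtie P$ is $\xrightarrow{\tau}\delta_{\mathsf{Dead}}$. If $\xi_x\in inv$: a transition $P\xrightarrow{\lambda}\pi$ with $\lambda$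 equal to $\tau$, an output or an input gives $E;\sigma\bowtie P\xrightarrow{\lambda}E;\delta_\sigma\bowtie\pi$; a transition $P\xrightarrow{s?z}\pi$ gives $\xrightarrow{\tau}E;\delta_\sigma\bowtie\pi\{\xi_s(s)/z\}$; a transition $P\xrightarrow{a!v}\pi$ with $v\in\mathbb R$ gives $\xrightarrow{\tau}E;\delta_{\sigma'}\bowtie\pi$, where $\sigma'=\langle\xi_x,\xi_s,\xi_a[a\mapsto v]\rangle$; and if $P\xrightarrow{\mathsf{tick}}\pi$ and the system has no $\tau$-transition, then $\xrightarrow{\mathsf{tick}}E;next_E(\sigma)\bowtie\pi$, where $next_E(\sigma)$ draws $\xi_x'$ from $evol(\xi_x,\xi_a)$, then $\xi_s'$ from $meas(\xi_x')$, and returns $\langle\xi_x',\xi_s',\xi_a\rangle$. We write $M\parallel Q$ and $M\backslash c$ for the same operations on the process of $M$. For physically disjoint systems (with disjoint state variables, sensors and actuators), $M_1\uplus M_2$ is the system $(E_1\uplus E_2);(\sigma_1\uplus\sigma_2)\bowtie(P_1\parallel P_2)$, where the state functions are joined, evolution and measurement are the product distributions, and the invariant is the conjunction of the two invariants. \textbf{Bisimilarity.}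 Write $M\xrightarrow{\hat\alpha}\gamma$ if $M\xrightarrow{\alpha}\gamma$, or $\alpha=\tau$ and $\gamma=\delta_M$. For finite-support sub-distributions, $\gamma\xrightarrow{\hat\alpha}\gamma'$ means that $\gamma=\sum_{i\in I}p_i\delta_{M_i}$ with $I$ finite and all $p_i>0$, and that there is a non-empty $J\subseteq I$ with $M_j\xrightarrow{\hat\alpha}\gamma_j$ for $j\in J$, no $\hat\alpha$-transition from $M_i$ for $i\notin J$, and $\gamma'=\sum_{j\in J}p_j\gamma_j$. Let $\stackrel{\hat\tau}{\Longrightarrow}$ be the reflexive transitive closure of $\xrightarrow{\hat\tau}$, and for $\alpha\ne\tau$ let $\stackrel{\hat\alpha}{\Longrightarrow}$ be $\stackrel{\hat\tau}{\Longrightarrow}\xrightarrow{\hat\alpha}\stackrel{\hat\tau}{\Longrightarrow}$. A symmetric relation $\mathcal R$ on CPSs is a weak probabilistic bisimulation if, whenever $M\,\mathcal R\,N$ and $M\xrightarrow{\alpha}\gamma$, there are a distribution $\gamma'$ with $\delta_N\stackrel{\hat\alpha}{\Longrightarrow}\gamma'$ and a distribution $\omega$ on pairs of CPSs with marginals $\gamma,\gamma'$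 such that $M'\,\mathcal R\,N'$ whenever $\omega(M',N')>0$. We write $M\approx N$ if $M\,\mathcal R\,N$ for some weak probabilistic bisimulation $\mathcal R$. \textbf{The airplane.} Let $g\in\mathbb N^{+}$, $\delta=0.4$, $err=0.1$, and $[v,w]_g=\{k\in[v,w]: k=v+h\cdot10^{-g},\ h\in\mathbb N\}$. For $\kappa>0$ and an identifier $\mathrm{ID}$, the engine $\mathit{Eng}_g(\kappa)$ has one state variable $temp$, one sensor $s_t$ and one actuator $cool$ (which is off if its value is $\geq0$ and on if it is $<0$), initially with $temp=0$, $s_t=0$ and $cool=\mathrm{off}$. Its evolution adds to $temp$ a value drawn uniformly from $[1-\delta,1+\delta]_g$ if $cool$ is off and from $[-\kappa-\delta,-\kappa+\delta]_g$ if $cool$ is on; its measurement sets $s_t$ to $temp$ plus a value drawn uniformly from $[-err,err]_g$; its invariant is $0\le temp\le30$. Its process is $$\mathit{Ctrl}=\mathsf{fix}\,X.\ \mathsf{read}\,x\,s_t.\ \mathsf{if}\,(x>10)\,\{\mathit{Cooling}\}\,\mathsf{else}\,\{\mathsf{tick}.X\},$$ $$\mathit{Cooling}=\mathsf{write}\,\mathrm{on}\,cool.\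 \mathsf{fix}\,Y.\ \mathsf{tick}^5.\ \mathsf{read}\,x\,s_t.\ \mathsf{if}\,(x>10)\,\{\overline{warning}\langle \mathrm{ID}\rangle.Y\}\,\mathsf{else}\,\{\mathsf{write}\,\mathrm{off}\,cool.\mathsf{tick}.X\},$$ where $chn.P$ stands for $\mathsf{fix}\,Z.\lfloor chn.P\rfloor Z$ with $Z$ not occurring in $P$. Let $\mathit{Eng}_g=\mathit{Eng}_g(1)$, and let $\widetilde{\mathit{Eng}_g}=\mathit{Eng}_g(0.8)$ be the engine with cooling power reduced by $20\%$. The superscripts $\mathrm L$ and $\mathrm R$ denote copies with $\mathrm{ID}$ replaced by the distinct names $\mathrm L$ and $\mathrm R$, respectively, and with disjointly renamed state variable, sensor and actuator. For distinct channels $warning,alarm,failure$, let $$\mathit{Check}=\mathsf{fix}\,X.\lfloor warning(x).\,\mathsf{if}\,(x=\mathrm L)\,\{\mathit{Check}^{\mathrm L}_1\}\,\mathsf{else}\,\{\mathit{Check}^{\mathrm R}_1\}\rfloor X,$$ $$\mathit{Check}^{id}_i=\lfloor warning(y).\,\mathsf{if}\,(y\ne id)\,\{\overline{alarm}.\mathsf{tick}.X\}\,\mathsf{else}\,\{\mathsf{tick}.\mathit{Check}^{id}_{i+1}\}\rfloor\mathit{Check}^{id}_{i+1}\qquad(1\le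 i\le4),$$ $$\mathit{Check}^{id}_5=\lfloor warning(z).\,\mathsf{if}\,(z\ne id)\,\{\overline{alarm}.\mathsf{tick}.X\}\,\mathsf{else}\,\{\overline{failure}\langle id\rangle.\mathsf{tick}.X\}\rfloor\,\overline{failure}\langle id\rangle.X,$$ and set $$\mathit{Airplane}_g=\big((\mathit{Eng}_g^{\mathrm L}\uplus\mathit{Eng}_g^{\mathrm R})\parallel\mathit{Check}\big)\backslash warning,\qquad \widetilde{\mathit{Airplane}_g}=\big((\widetilde{\mathit{Eng}_g^{\mathrm L}}\uplus\widetilde{\mathit{Eng}_g^{\mathrm R}})\parallel\mathit{Check}\big)\backslash warning.$$ \textbf{Proposition.} For every $g\in\mathbb N^{+}$, $\mathit{Airplane}_g\approx\widetilde{\mathit{Airplane}_g}$. -/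

import Mathlib

open scoped ENNReal

namespace CPSCalc

/-! ## Discrete distributions

Distributions are Mathlib's `PMF`s.  All those that occur below have finite support. -/

/-- The weights `(p_i)_{i ∈ I}` of a probabilistic choice: `I = Fin n` is finite (and necessarily
non-empty), every `p_i` is positive, and they add up to one. -/
structure Weights where
  n : ℕ
  prob : PMF (Fin n)
  pos : ∀ i, prob i ≠ 0

/-- A guarded probabilistic choice `⨁_{i ∈ I} p_i : P_i`. -/
structure Choice (T : Type) where
  weights : Weights
  branch : Fin weights.n → T

/-- The one-branch choice `1 : P`. -/
noncomputable def Choice.point {T : Type} (P : T) : Choice T where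
  weights :=
    { n := 1
      prob := PMF.pure 0
      pos := fun i => by rw [Subsingleton.elim i 0]; simp }
  branch := fun _ => P

/-- The distribution `⟦⨁ p_i : P_i⟧ = ∑ p_i · δ_{P_i}`. -/
noncomputable def Choice.sem {T : Type} (C : Choice T) : PMF T :=
  C.weights.prob.map C.branch

/-! ## Syntax of (logical) processes -/

/-- Values: real numbers, Booleans, names, and a value for pure synchronisation. -/
inductive Value where
  | real (r : ℝ)
  | bool (b : Bool)
  | name (n : ℕ)
  | unit

/-- Data expressions: values and data variables. -/
inductive Expr where
  | val (v : Value)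
  | var (x : ℕ)

/-- The substitution `e{v/x}`. -/
def Expr.subst (x : ℕ) (v : Value) : Expr → Expr
  | .val w => .val w
  | .var y => if y = x then .val v else .var y

/-- Boolean guards. -/
inductive Guard where
  | eq (e₁ e₂ : Expr)
  | lt (e₁ e₂ : Expr)
  | not (b : Guard)
  | and (b₁ b₂ : Guard)

/-- The substitution `b{v/x}`. -/
def Guard.subst (x : ℕ) (v : Value) : Guard → Guard
  | .eq e₁ e₂ => .eq (e₁.subst x v) (e₂.subst x v)
  | .lt e₁ e₂ => .lt (e₁.subst x v) (e₂.subst x v)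
  | .not b => .not (b.subst x v)
  | .and b₁ b₂ => .and (b₁.subst x v) (b₂.subst x v)

/-- Truth of a (closed) guard.  An order comparison holds only between real numbers. -/
def Guard.Holds : Guard → Prop
  | .eq e₁ e₂ => e₁ = e₂
  | .lt (.val (.real r₁)) (.val (.real r₂)) => r₁ < r₂
  | .lt _ _ => False
  | .not b => ¬ b.Holds
  | .and b₁ b₂ => b₁.Holds ∧ b₂.Holds

/-- Channel prefixes: output of an expression and input into a data variable. -/
inductive Chn where
  | out (c : ℕ) (e : Expr)
  | inp (c : ℕ) (x : ℕ)

/-- Processes over the sensors in `S` and the actuators in `A`.  Data variables, process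
variables and channels are natural numbers.  Since the sensors and actuators that can be mentioned
are those in `S` and `A`, systems are well-formed by construction. -/
inductive Proc (S A : Type) where
  | nil
  | tick (C : Choice (Proc S A))
  | par (P Q : Proc S A)
  | timeout (chn : Chn) (C D : Choice (Proc S A))
  | read (x : ℕ) (s : S) (C : Choice (Proc S A))
  | write (e : Expr) (a : A) (C : Choice (Proc S A))
  | ite (b : Guard) (P Q : Proc S A)
  | res (P : Proc S A) (c : ℕ)
  | pvar (X : ℕ)
  | fix (X : ℕ) (P : Proc S A)

namespace Proc

variable {S A S' A' : Type}

/-- The substitution `P{v/x}` of a value for a data variable; `⌊c?x.C⌋D` and `read x s.C` bind `x`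
in `C`. -/
def subst (x : ℕ) (v : Value) : Proc S A → Proc S A
  | .nil => .nil
  | .tick ⟨w, B⟩ => .tick ⟨w, fun i => (B i).subst x v⟩
  | .par P Q => .par (P.subst x v) (Q.subst x v)
  | .timeout (.out c e) ⟨w, B⟩ ⟨w', B'⟩ =>
      .timeout (.out c (e.subst x v)) ⟨w, fun i => (B i).subst x v⟩
        ⟨w', fun i => (B' i).subst x v⟩
  | .timeout (.inp c y) ⟨w, B⟩ ⟨w', B'⟩ =>
      .timeout (.inp c y) ⟨w, fun i => if y = x then B i else (B i).subst x v⟩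
        ⟨w', fun i => (B' i).subst x v⟩
  | .read y s ⟨w, B⟩ => .read y s ⟨w, fun i => if y = x then B i else (B i).subst x v⟩
  | .write e a ⟨w, B⟩ => .write (e.subst x v) a ⟨w, fun i => (B i).subst x v⟩
  | .ite b P Q => .ite (b.subst x v) (P.subst x v) (Q.subst x v)
  | .res P c => .res (P.subst x v) c
  | .pvar X => .pvar X
  | .fix X P => .fix X (P.subst x v)

/-- The substitution `P{R/X}` of a process for a process variable.  It is only used with closed
`R`, so that no capture can occur. -/
def psubst (X : ℕ) (R : Proc S A) : Proc S A → Proc S A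
  | .nil => .nil
  | .tick ⟨w, B⟩ => .tick ⟨w, fun i => psubst X R (B i)⟩
  | .par P Q => .par (psubst X R P) (psubst X R Q)
  | .timeout chn ⟨w, B⟩ ⟨w', B'⟩ =>
      .timeout chn ⟨w, fun i => psubst X R (B i)⟩ ⟨w', fun i => psubst X R (B' i)⟩
  | .read y s ⟨w, B⟩ => .read y s ⟨w, fun i => psubst X R (B i)⟩
  | .write e a ⟨w, B⟩ => .write e a ⟨w, fun i => psubst X R (B i)⟩
  | .ite b P Q => .ite b (psubst X R P) (psubst X R Q)
  | .res P c => .res (psubst X R P) c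
  | .pvar Y => if Y = X then R else .pvar Y
  | .fix Y P => if Y = X then .fix Y P else .fix Y (psubst X R P)

/-- Renaming of sensors and actuators. -/
def rename (f : S → S') (h : A → A') : Proc S A → Proc S' A'
  | .nil => .nil
  | .tick ⟨w, B⟩ => .tick ⟨w, fun i => (B i).rename f h⟩
  | .par P Q => .par (P.rename f h) (Q.rename f h)
  | .timeout chn ⟨w, B⟩ ⟨w', B'⟩ =>
      .timeout chn ⟨w, fun i => (B i).rename f h⟩ ⟨w', fun i => (B' i).rename f h⟩
  | .read y s ⟨w, B⟩ => .read y (f s) ⟨w, fun i => (B i).rename f h⟩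
  | .write e a ⟨w, B⟩ => .write e (h a) ⟨w, fun i => (B i).rename f h⟩
  | .ite b P Q => .ite b (P.rename f h) (Q.rename f h)
  | .res P c => .res (P.rename f h) c
  | .pvar X => .pvar X
  | .fix X P => .fix X (P.rename f h)

/-- `tick.P` -/
noncomputable def sleep (P : Proc S A) : Proc S A := .tick (.point P)

/-- `tick^k.P` -/
noncomputable def sleeps : ℕ → Proc S A → Proc S A
  | 0, P => P
  | k + 1, P => sleep (sleeps k P)

/-- The persistent prefix `chn.P`, i.e. `fix Z ⌊chn.P⌋Z`; the process variable `Z` is to be chosen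
so that it does not occur in `P`. -/
noncomputable def prefixed (Z : ℕ) (chn : Chn) (P : Proc S A) : Proc S A :=
  .fix Z (.timeout chn (.point P) (.point (.pvar Z)))

/-! ## Labelled transition semantics of processes -/

end Proc

/-- Labels of process transitions: time, internal activity, transmission, reception, actuator
writing, and sensor reading (into a data variable). -/
inductive Label (S A : Type) where
  | tick
  | tau
  | out (c : ℕ) (v : Value)
  | inp (c : ℕ) (v : Value)
  | write (a : A) (v : Value)
  | read (s : S) (x : ℕ)

namespace Proc

variable {S A : Type}

/-- `π₁ ∥ π₂` -/
noncomputable def parDist (π₁ π₂ : PMF (Proc S A)) : PMF (Proc S A) :=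
  π₁.bind fun P => π₂.map fun Q => .par P Q

/-- `π \ c` -/
noncomputable def resDist (π : PMF (Proc S A)) (c : ℕ) : PMF (Proc S A) :=
  π.map fun P => .res P c

/-- The instantaneous transitions of processes (those with a label other than `tick`).
A conditional is identified with the branch selected by its guard. -/
inductive Inst : Proc S A → Label S A → PMF (Proc S A) → Prop
  | outp (c : ℕ) (v : Value) (C D : Choice (Proc S A)) :
      Inst (.timeout (.out c (.val v)) C D) (.out c v) C.sem
  | inpp (c x : ℕ) (v : Value) (C D : Choice (Proc S A)) :
      Inst (.timeout (.inp c x) C D) (.inp c v) (C.sem.map (subst x v))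
  | write (v : Value) (a : A) (C : Choice (Proc S A)) :
      Inst (.write (.val v) a C) (.write a v) C.sem
  | read (x : ℕ) (s : S) (C : Choice (Proc S A)) :
      Inst (.read x s C) (.read s x) C.sem
  | comL {P₁ P₂ : Proc S A} {c : ℕ} {v : Value} {π₁ π₂ : PMF (Proc S A)} :
      Inst P₁ (.out c v) π₁ → Inst P₂ (.inp c v) π₂ →
      Inst (.par P₁ P₂) .tau (parDist π₁ π₂)
  | comR {P₁ P₂ : Proc S A} {c : ℕ} {v : Value} {π₁ π₂ : PMF (Proc S A)} :
      Inst P₁ (.inp c v) π₁ → Inst P₂ (.out c v) π₂ →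
      Inst (.par P₁ P₂) .tau (parDist π₁ π₂)
  | parL {P Q : Proc S A} {l : Label S A} {π : PMF (Proc S A)} :
      Inst P l π → Inst (.par P Q) l (parDist π (PMF.pure Q))
  | parR {P Q : Proc S A} {l : Label S A} {π : PMF (Proc S A)} :
      Inst Q l π → Inst (.par P Q) l (parDist (PMF.pure P) π)
  | chnRes {P : Proc S A} {c : ℕ} {l : Label S A} {π : PMF (Proc S A)} :
      Inst P l π → (∀ v, l ≠ .inp c v ∧ l ≠ .out c v) →
      Inst (.res P c) l (resDist π c)
  | recur {X : ℕ} {P : Proc S A} {l : Label S A} {π : PMF (Proc S A)} :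
      Inst (psubst X (.fix X P) P) l π → Inst (.fix X P) l π
  | ifTrue {b : Guard} {P Q : Proc S A} {l : Label S A} {π : PMF (Proc S A)} :
      b.Holds → Inst P l π → Inst (.ite b P Q) l π
  | ifFalse {b : Guard} {P Q : Proc S A} {l : Label S A} {π : PMF (Proc S A)} :
      ¬ b.Holds → Inst Q l π → Inst (.ite b P Q) l π

/-- The timed transitions of processes (those labelled `tick`).  They are defined after the
instantaneous ones because of the negative premise of the rule for parallel composition. -/
inductive Timed : Proc S A → PMF (Proc S A) → Prop
  | timeNil : Timed .nil (PMF.pure .nil)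
  | delay (C : Choice (Proc S A)) : Timed (.tick C) C.sem
  | timeout (chn : Chn) (C D : Choice (Proc S A)) : Timed (.timeout chn C D) D.sem
  | timePar {P₁ P₂ : Proc S A} {π₁ π₂ : PMF (Proc S A)} :
      Timed P₁ π₁ → Timed P₂ π₂ → (¬ ∃ π, Inst (.par P₁ P₂) .tau π) →
      Timed (.par P₁ P₂) (parDist π₁ π₂)
  | chnRes {P : Proc S A} {c : ℕ} {π : PMF (Proc S A)} :
      Timed P π → Timed (.res P c) (resDist π c)
  | recur {X : ℕ} {P : Proc S A} {π : PMF (Proc S A)} :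
      Timed (psubst X (.fix X P) P) π → Timed (.fix X P) π
  | ifTrue {b : Guard} {P Q : Proc S A} {π : PMF (Proc S A)} :
      b.Holds → Timed P π → Timed (.ite b P Q) π
  | ifFalse {b : Guard} {P Q : Proc S A} {π : PMF (Proc S A)} :
      ¬ b.Holds → Timed Q π → Timed (.ite b P Q) π

end Proc

/-! ## Physical components -/

/-- A physical state over state variables `X`, sensors `S`, and actuators `A`. -/
structure PhysState (X S A : Type) where
  x : X → ℝ
  s : S → ℝ
  a : A → ℝ

open Classical in
/-- The physical state with the actuator function updated to `ξ_a[a ↦ v]`. -/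
noncomputable def PhysState.setAct {X S A : Type} (σ : PhysState X S A) (a : A) (v : ℝ) :
    PhysState X S A :=
  { σ with a := Function.update σ.a a v }

/-- A physical environment: evolution map, measurement map, and invariant set. -/
structure PhysEnv (X S A : Type) where
  evol : (X → ℝ) → (A → ℝ) → PMF (X → ℝ)
  evol_finite : ∀ x a, (evol x a).support.Finite
  meas : (X → ℝ) → PMF (S → ℝ)
  meas_finite : ∀ x, (meas x).support.Finite
  inv : Set (X → ℝ)

/-- The distribution `next_E(σ)` over the physical states of the next time slot. -/
noncomputable def PhysEnv.next {X S A : Type} (E : PhysEnv X S A) (σ : PhysState X S A) :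
    PMF (PhysState X S A) :=
  (E.evol σ.x σ.a).bind fun x' => (E.meas x').map fun s' => ⟨x', s', σ.a⟩

/-- Disjoint union of physical states; disjointness of the sets of names is ensured by tagging. -/
def PhysState.uplus {X₁ S₁ A₁ X₂ S₂ A₂ : Type} (σ₁ : PhysState X₁ S₁ A₁)
    (σ₂ : PhysState X₂ S₂ A₂) : PhysState (X₁ ⊕ X₂) (S₁ ⊕ S₂) (A₁ ⊕ A₂) where
  x := Sum.elim σ₁.x σ₂.x
  s := Sum.elim σ₁.s σ₂.s
  a := Sum.elim σ₁.a σ₂.a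

/-- The product of two distributions over functions, as a distribution over functions on the
disjoint union of the domains. -/
noncomputable def sumDist {Y₁ Y₂ : Type} (p : PMF (Y₁ → ℝ)) (q : PMF (Y₂ → ℝ)) :
    PMF (Y₁ ⊕ Y₂ → ℝ) :=
  p.bind fun f => q.map fun h => Sum.elim f h

theorem sumDist_finite {Y₁ Y₂ : Type} {p : PMF (Y₁ → ℝ)} {q : PMF (Y₂ → ℝ)}
    (hp : p.support.Finite) (hq : q.support.Finite) : (sumDist p q).support.Finite := by
  simp only [sumDist, PMF.support_bind, PMF.support_map]
  exact hp.biUnion fun f _ => hq.image _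

/-- Disjoint union of physical environments. -/
noncomputable def PhysEnv.uplus {X₁ S₁ A₁ X₂ S₂ A₂ : Type} (E₁ : PhysEnv X₁ S₁ A₁)
    (E₂ : PhysEnv X₂ S₂ A₂) : PhysEnv (X₁ ⊕ X₂) (S₁ ⊕ S₂) (A₁ ⊕ A₂) where
  evol x a := sumDist (E₁.evol (x ∘ Sum.inl) (a ∘ Sum.inl)) (E₂.evol (x ∘ Sum.inr) (a ∘ Sum.inr))
  evol_finite _ _ := sumDist_finite (E₁.evol_finite _ _) (E₂.evol_finite _ _)
  meas x := sumDist (E₁.meas (x ∘ Sum.inl)) (E₂.meas (x ∘ Sum.inr))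
  meas_finite _ := sumDist_finite (E₁.meas_finite _) (E₂.meas_finite _)
  inv := {x | x ∘ Sum.inl ∈ E₁.inv ∧ x ∘ Sum.inr ∈ E₂.inv}

/-! ## Cyber-physical systems -/

/-- Cyber-physical systems `E; σ ⋈ P` over `X`, `S`, `A`, and the deadlocked system `Dead`. -/
inductive CPS (X S A : Type) where
  | conf (E : PhysEnv X S A) (σ : PhysState X S A) (P : Proc S A)
  | dead

/-- Actions of cyber-physical systems. -/
inductive Act where
  | tau
  | out (c : ℕ) (v : Value)
  | inp (c : ℕ) (v : Value)
  | tick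

namespace CPS

variable {X S A : Type}

/-- `M ∥ Q`, for a process `Q` that is to be pure-logical. -/
def par : CPS X S A → Proc S A → CPS X S A
  | .conf E σ P, Q => .conf E σ (.par P Q)
  | .dead, _ => .dead

/-- `M \ c` -/
def res : CPS X S A → ℕ → CPS X S A
  | .conf E σ P, c => .conf E σ (.res P c)
  | .dead, _ => .dead

/-- `M₁ ⊎ M₂`, where the two systems are made physically disjoint by tagging their state
variables, sensors and actuators with `Sum.inl` and `Sum.inr`, respectively. -/
noncomputable def uplus {X₁ S₁ A₁ X₂ S₂ A₂ : Type} :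
    CPS X₁ S₁ A₁ → CPS X₂ S₂ A₂ → CPS (X₁ ⊕ X₂) (S₁ ⊕ S₂) (A₁ ⊕ A₂)
  | .conf E₁ σ₁ P₁, .conf E₂ σ₂ P₂ =>
      .conf (E₁.uplus E₂) (σ₁.uplus σ₂)
        (.par (P₁.rename Sum.inl Sum.inl) (P₂.rename Sum.inr Sum.inr))
  | .dead, _ => .dead
  | .conf _ _ _, .dead => .dead

/-- The distribution `E; ς ⋈ π`, for distributions `ς` over physical states and `π` over
processes. -/
noncomputable def confDist (E : PhysEnv X S A) (ς : PMF (PhysState X S A))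
    (π : PMF (Proc S A)) : PMF (CPS X S A) :=
  ς.bind fun σ => π.map fun P => .conf E σ P

/-- The instantaneous transitions of cyber-physical systems. -/
inductive Inst : CPS X S A → Act → PMF (CPS X S A) → Prop
  | out {E : PhysEnv X S A} {σ : PhysState X S A} {P : Proc S A} {π : PMF (Proc S A)}
      {c : ℕ} {v : Value} :
      P.Inst (.out c v) π → σ.x ∈ E.inv →
      Inst (.conf E σ P) (.out c v) (confDist E (PMF.pure σ) π)
  | inp {E : PhysEnv X S A} {σ : PhysState X S A} {P : Proc S A} {π : PMF (Proc S A)}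
      {c : ℕ} {v : Value} :
      P.Inst (.inp c v) π → σ.x ∈ E.inv →
      Inst (.conf E σ P) (.inp c v) (confDist E (PMF.pure σ) π)
  | tau {E : PhysEnv X S A} {σ : PhysState X S A} {P : Proc S A} {π : PMF (Proc S A)} :
      P.Inst .tau π → σ.x ∈ E.inv →
      Inst (.conf E σ P) .tau (confDist E (PMF.pure σ) π)
  | sensRead {E : PhysEnv X S A} {σ : PhysState X S A} {P : Proc S A} {π : PMF (Proc S A)}
      {s : S} {z : ℕ} :
      P.Inst (.read s z) π → σ.x ∈ E.inv →
      Inst (.conf E σ P) .tau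
        (confDist E (PMF.pure σ) (π.map (Proc.subst z (.real (σ.s s)))))
  | actWrite {E : PhysEnv X S A} {σ : PhysState X S A} {P : Proc S A} {π : PMF (Proc S A)}
      {a : A} {v : ℝ} :
      P.Inst (.write a (.real v)) π → σ.x ∈ E.inv →
      Inst (.conf E σ P) .tau (confDist E (PMF.pure (σ.setAct a v)) π)
  | deadlock {E : PhysEnv X S A} {σ : PhysState X S A} {P : Proc S A} :
      σ.x ∉ E.inv → Inst (.conf E σ P) .tau (PMF.pure .dead)

/-- The transitions `M --α--> γ` of cyber-physical systems. -/
inductive Trans : CPS X S A → Act → PMF (CPS X S A) → Prop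
  | inst {M : CPS X S A} {α : Act} {γ : PMF (CPS X S A)} : Inst M α γ → Trans M α γ
  | time {E : PhysEnv X S A} {σ : PhysState X S A} {P : Proc S A} {π : PMF (Proc S A)} :
      P.Timed π → (¬ ∃ γ, Inst (.conf E σ P) .tau γ) → σ.x ∈ E.inv →
      Trans (.conf E σ P) .tick (confDist E (E.next σ) π)

/-! ## Weak transitions and weak probabilistic bisimilarity -/

/-- `M --α̂--> γ`: either `M --α--> γ`, or `α = τ` and `γ = δ_M`. -/
def HatTrans (M : CPS X S A) (α : Act) (γ : PMF (CPS X S A)) : Prop :=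
  Trans M α γ ∨ (α = .tau ∧ γ = PMF.pure M)

/-- `--α̂-->` between (finite-support) sub-distributions, given by their mass functions:
`γ` can be written as `∑_{i ∈ I} p_i · δ_{M_i}` in such a way that, for some non-empty `J ⊆ I`,
`M_j --α̂--> γ_j` for `j ∈ J`, no other `M_i` has an `α̂`-transition, and
`γ' = ∑_{j ∈ J} p_j · γ_j`. -/
def LiftTrans (α : Act) (γ γ' : CPS X S A → ℝ≥0∞) : Prop :=
  ∃ (n : ℕ) (p : Fin n → ℝ≥0∞) (M : Fin n → CPS X S A) (J : Finset (Fin n))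
    (Γ : Fin n → PMF (CPS X S A)),
    (∀ i, 0 < p i) ∧ ∑ i, p i ≤ 1 ∧
    γ = (fun N => ∑ i, p i * PMF.pure (M i) N) ∧
    J.Nonempty ∧
    (∀ j ∈ J, HatTrans (M j) α (Γ j)) ∧
    (∀ i ∉ J, ¬ ∃ δ, HatTrans (M i) α δ) ∧
    γ' = (fun N => ∑ j ∈ J, p j * Γ j N)

/-- The weak transition `==τ̂==>`: the reflexive and transitive closure of `--τ̂-->`. -/
def WeakTau : (CPS X S A → ℝ≥0∞) → (CPS X S A → ℝ≥0∞) → Prop :=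
  Relation.ReflTransGen (LiftTrans .tau)

/-- The weak transition `==α̂==>` between sub-distributions. -/
def Weak (α : Act) (γ γ' : CPS X S A → ℝ≥0∞) : Prop :=
  (α = .tau ∧ WeakTau γ γ') ∨
  (α ≠ .tau ∧ ∃ γ₁ γ₂, WeakTau γ γ₁ ∧ LiftTrans α γ₁ γ₂ ∧ WeakTau γ₂ γ')

/-- `ω` is a matching (coupling) for the pair `(γ, γ')`. -/
def IsMatching (ω : PMF (CPS X S A × CPS X S A)) (γ γ' : PMF (CPS X S A)) : Prop :=
  (∀ M, ∑' M', ω (M, M') = γ M) ∧ (∀ M', ∑' M, ω (M, M') = γ' M')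

/-- Weak probabilistic bisimulations. -/
def IsWeakBisimulation (R : CPS X S A → CPS X S A → Prop) : Prop :=
  (∀ M N, R M N → R N M) ∧
  ∀ M N, R M N → ∀ α γ, Trans M α γ →
    ∃ (γ' : PMF (CPS X S A)) (ω : PMF (CPS X S A × CPS X S A)),
      IsMatching ω γ γ' ∧ Weak α (PMF.pure N) γ' ∧ ∀ M' N', 0 < ω (M', N') → R M' N'

/-- Weak probabilistic bisimilarity `M ≈ N`. -/
def Bisimilar (M N : CPS X S A) : Prop :=
  ∃ R : CPS X S A → CPS X S A → Prop, IsWeakBisimulation R ∧ R M N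

end CPS

/-! ## The engine -/

/-- The grid `[v,w]_g = {k ∈ [v,w] : k = v + h · 10^{-g} for some h ∈ ℕ}`. -/
def grid (g : ℕ) (v w : ℝ) : Set ℝ :=
  {k | k ∈ Set.Icc v w ∧ ∃ h : ℕ, k = v + h / 10 ^ g}

theorem grid_finite (g : ℕ) (v w : ℝ) : (grid g v w).Finite := by
  have hpos : (0 : ℝ) < 10 ^ g := by positivity
  refine (((Set.finite_Iic ⌊(w - v) * 10 ^ g⌋₊).image
    fun h : ℕ => v + (h : ℝ) / 10 ^ g)).subset ?_
  rintro k ⟨⟨_, hw⟩, h, rfl⟩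
  refine ⟨h, Nat.le_floor ?_, rfl⟩
  have h1 : (h : ℝ) / 10 ^ g ≤ w - v := by linarith
  exact (div_le_iff₀ hpos).mp h1

theorem grid_nonempty (g : ℕ) {v w : ℝ} (h : v ≤ w) : (grid g v w).Nonempty :=
  ⟨v, ⟨le_refl v, h⟩, 0, by simp⟩

/-- The uniform distribution over the grid `[v,w]_g`, for `v ≤ w`. -/
noncomputable def unifGrid (g : ℕ) (v w : ℝ) (h : v ≤ w) : PMF ℝ :=
  PMF.uniformOfFinset (grid_finite g v w).toFinset
    ((grid_finite g v w).toFinset_nonempty.mpr (grid_nonempty g h))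

theorem unifGrid_finite (g : ℕ) (v w : ℝ) (h : v ≤ w) : (unifGrid g v w h).support.Finite := by
  rw [unifGrid, PMF.support_uniformOfFinset]
  exact Finset.finite_toSet _

/-- The only state variable of the engine. -/
inductive EngVar where
  | temp

/-- The only sensor of the engine. -/
inductive EngSensor where
  | st

/-- The only actuator of the engine. -/
inductive EngActuator where
  | cool

/-- Reals representing `off` and `on`: non-negative means `off`, negative means `on`. -/
def offVal : ℝ := 1

/-- See `offVal`. -/
def onVal : ℝ := -1

/-- The uncertainty `δ = 0.4`. -/
noncomputable def delta : ℝ := 0.4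

/-- The measurement error `err = 0.1`. -/
noncomputable def err : ℝ := 0.1

open Classical in
/-- The mean temperature drift per time unit: `1` if cooling is off, `-κ` if it is on. -/
noncomputable def drift (κ : ℝ) (a : EngActuator → ℝ) : ℝ :=
  if 0 ≤ a .cool then 1 else -κ

theorem sub_delta_le (m : ℝ) : m - delta ≤ m + delta := by
  have : (0 : ℝ) ≤ delta := by norm_num [delta]
  linarith

theorem neg_err_le : -err ≤ err := by norm_num [err]

/-- The physical environment of an engine with granularity `g` and cooling power `κ`: with
active cooling the temperature changes by a value in `[-κ-δ, -κ+δ]_g`. -/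
noncomputable def engEnv (g : ℕ) (κ : ℝ) : PhysEnv EngVar EngSensor EngActuator where
  evol x a := (unifGrid g (drift κ a - delta) (drift κ a + delta) (sub_delta_le _)).map
    fun v => fun _ => x .temp + v
  evol_finite x a := by
    rw [PMF.support_map]
    exact (unifGrid_finite _ _ _ _).image _
  meas x := (unifGrid g (-err) err neg_err_le).map fun v => fun _ => x .temp + v
  meas_finite x := by
    rw [PMF.support_map]
    exact (unifGrid_finite _ _ _ _).image _
  inv := {x | 0 ≤ x .temp ∧ x .temp ≤ 30}

/-- The initial physical state of an engine. -/
def engState : PhysState EngVar EngSensor EngActuator where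
  x := fun _ => 0
  s := fun _ => 0
  a := fun _ => offVal

/-- The channel `warning`. -/
def warning : ℕ := 0

/-- The channel `alarm`. -/
def alarm : ℕ := 1

/-- The channel `failure`. -/
def failure : ℕ := 2

/-- The engine identifier `L`. -/
def idL : Value := .name 0

/-- The engine identifier `R`. -/
def idR : Value := .name 1

/-- The guard `x > 10` on the data variable `0`. -/
noncomputable def isHot : Guard := .lt (.val (.real 10)) (.var 0)

/-- `Cooling`, with free process variable `X = 0`:
`write on cool. fix Y tick⁵. read x s_t. if (x > 10) {warning!ID.Y} else {write off cool. tick. X}`,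
where `Y = 1`. -/
noncomputable def cooling (ident : Value) : Proc EngSensor EngActuator :=
  .write (.val (.real onVal)) .cool <| .point <| .fix 1 <| Proc.sleeps 5 <|
    .read 0 .st <| .point <| .ite isHot
      (Proc.prefixed 2 (.out warning (.val ident)) (.pvar 1))
      (.write (.val (.real offVal)) .cool <| .point <| Proc.sleep <| .pvar 0)

/-- `Ctrl = fix X read x s_t. if (x > 10) {Cooling} else {tick.X}`. -/
noncomputable def ctrl (ident : Value) : Proc EngSensor EngActuator :=
  .fix 0 <| .read 0 .st <| .point <| .ite isHot (cooling ident) (Proc.sleep (.pvar 0))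

/-- The engine with identifier `ident`, granularity `g` and cooling power `κ`. -/
noncomputable def engine (g : ℕ) (κ : ℝ) (ident : Value) : CPS EngVar EngSensor EngActuator :=
  .conf (engEnv g κ) engState (ctrl ident)

/-! ## The airplane -/

/-- `alarm!.tick.X`, with free process variable `X = 0`. -/
noncomputable def alarmThenTick {S A : Type} : Proc S A :=
  Proc.prefixed 1 (.out alarm (.val .unit)) (Proc.sleep (.pvar 0))

/-- `Check^id_{5-k}`, with free process variable `X = 0`, for `k = 0, …, 4`. -/
noncomputable def checkPhase {S A : Type} (ident : Value) : ℕ → Proc S A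
  | 0 => .timeout (.inp warning 0)
      (.point <| .ite (.not (.eq (.var 0) (.val ident))) alarmThenTick
        (Proc.prefixed 1 (.out failure (.val ident)) (Proc.sleep (.pvar 0))))
      (.point <| Proc.prefixed 1 (.out failure (.val ident)) (.pvar 0))
  | k + 1 => .timeout (.inp warning 0)
      (.point <| .ite (.not (.eq (.var 0) (.val ident))) alarmThenTick
        (Proc.sleep (checkPhase ident k)))
      (.point <| checkPhase ident k)

/-- `Check = fix X ⌊warning?x. if (x = L) {Check^L_1} else {Check^R_1}⌋X`. -/
noncomputable def check {S A : Type} : Proc S A :=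
  .fix 0 <| .timeout (.inp warning 0)
    (.point <| .ite (.eq (.var 0) (.val idL)) (checkPhase idL 4) (checkPhase idR 4))
    (.point <| .pvar 0)

/-- The airplane `((Eng^L ⊎ Eng^R) ∥ Check) \ warning` whose two engines have cooling power `κ`. -/
noncomputable def airplaneWith (g : ℕ) (κ : ℝ) :
    CPS (EngVar ⊕ EngVar) (EngSensor ⊕ EngSensor) (EngActuator ⊕ EngActuator) :=
  ((((engine g κ idL).uplus (engine g κ idR)).par check).res warning)

/-- `Airplane_g`: under active cooling, the temperatures drift by values in `[-1-δ, -1+δ]_g`. -/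
noncomputable def airplane (g : ℕ) :
    CPS (EngVar ⊕ EngVar) (EngSensor ⊕ EngSensor) (EngActuator ⊕ EngActuator) :=
  airplaneWith g 1

/-- The airplane with the engines whose cooling power is reduced by 20%: the drift under
cooling lies in `[-0.8-δ, -0.8+δ]_g`. -/
noncomputable def airplaneTilde (g : ℕ) :
    CPS (EngVar ⊕ EngVar) (EngSensor ⊕ EngSensor) (EngActuator ⊕ EngActuator) :=
  airplaneWith g 0.8

end CPSCalc

namespace CPSCalc

open Proc

namespace Proc

variable {S A S' A' : Type}

@[simp] theorem psubst_tick_point (X : ℕ) (R P : Proc S A) :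
    psubst X R (.tick (.point P)) = .tick (.point (psubst X R P)) := by
  simp only [Choice.point, psubst]

@[simp] theorem psubst_timeout_point (X : ℕ) (R P Q : Proc S A) (chn : Chn) :
    psubst X R (.timeout chn (.point P) (.point Q)) =
      .timeout chn (.point (psubst X R P)) (.point (psubst X R Q)) := by
  simp only [Choice.point, psubst]

@[simp] theorem psubst_read_point (X : ℕ) (R P : Proc S A) (x : ℕ) (s : S) :
    psubst X R (.read x s (.point P)) = .read x s (.point (psubst X R P)) := by
  simp only [Choice.point, psubst]

@[simp] theorem psubst_write_point (X : ℕ) (R P : Proc S A) (e : Expr) (a : A) :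
    psubst X R (.write e a (.point P)) = .write e a (.point (psubst X R P)) := by
  simp only [Choice.point, psubst]

@[simp] theorem psubst_ite (X : ℕ) (R P Q : Proc S A) (b : Guard) :
    psubst X R (.ite b P Q) = .ite b (psubst X R P) (psubst X R Q) := by
  simp only [psubst]

@[simp] theorem psubst_pvar (X Y : ℕ) (R : Proc S A) :
    psubst X R (.pvar Y) = if Y = X then R else .pvar Y := by
  simp only [psubst]

@[simp] theorem psubst_fix (X Y : ℕ) (R P : Proc S A) :
    psubst X R (.fix Y P) = if Y = X then .fix Y P else .fix Y (psubst X R P) := by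
  simp only [psubst]

@[simp] theorem subst_ite (x : ℕ) (v : Value) (P Q : Proc S A) (b : Guard) :
    subst x v (.ite b P Q) = .ite (b.subst x v) (subst x v P) (subst x v Q) := by
  simp only [subst]

@[simp] theorem subst_pvar (x X : ℕ) (v : Value) :
    subst x v (.pvar X : Proc S A) = .pvar X := by
  simp only [subst]

@[simp] theorem subst_fix (x X : ℕ) (v : Value) (P : Proc S A) :
    subst x v (.fix X P) = .fix X (subst x v P) := by
  simp only [subst]

@[simp] theorem subst_par (x : ℕ) (v : Value) (P Q : Proc S A) :
    subst x v (.par P Q) = .par (subst x v P) (subst x v Q) := by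
  simp only [subst]

@[simp] theorem subst_res (x c : ℕ) (v : Value) (P : Proc S A) :
    subst x v (.res P c) = .res (subst x v P) c := by
  simp only [subst]

@[simp] theorem rename_ite (f : S → S') (h : A → A') (P Q : Proc S A) (b : Guard) :
    rename f h (.ite b P Q) = .ite b (rename f h P) (rename f h Q) := by
  simp only [rename]

@[simp] theorem rename_pvar (f : S → S') (h : A → A') (X : ℕ) :
    rename f h (.pvar X : Proc S A) = .pvar X := by
  simp only [rename]

@[simp] theorem rename_fix (f : S → S') (h : A → A') (X : ℕ) (P : Proc S A) :
    rename f h (.fix X P) = .fix X (rename f h P) := by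
  simp only [rename]

@[simp] theorem subst_tick_point (x : ℕ) (v : Value) (P : Proc S A) :
    subst x v (.tick (.point P)) = .tick (.point (subst x v P)) := by
  simp only [Choice.point, subst]

@[simp] theorem subst_read_point (x y : ℕ) (v : Value) (s : S) (P : Proc S A) :
    subst x v (.read y s (.point P)) =
      .read y s (.point (if y = x then P else subst x v P)) := by
  simp only [Choice.point, subst]

@[simp] theorem subst_write_point (x : ℕ) (v : Value) (e : Expr) (a : A) (P : Proc S A) :
    subst x v (.write e a (.point P)) = .write (e.subst x v) a (.point (subst x v P)) := by
  simp only [Choice.point, subst]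

@[simp] theorem subst_timeout_out_point (x c : ℕ) (v : Value) (e : Expr) (P Q : Proc S A) :
    subst x v (.timeout (.out c e) (.point P) (.point Q)) =
      .timeout (.out c (e.subst x v)) (.point (subst x v P)) (.point (subst x v Q)) := by
  simp only [Choice.point, subst]

@[simp] theorem subst_timeout_inp_point (x c y : ℕ) (v : Value) (P Q : Proc S A) :
    subst x v (.timeout (.inp c y) (.point P) (.point Q)) =
      .timeout (.inp c y) (.point (if y = x then P else subst x v P)) (.point (subst x v Q)) := by
  simp only [Choice.point, subst]

@[simp] theorem rename_tick_point (f : S → S') (h : A → A') (P : Proc S A) :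
    rename f h (.tick (.point P)) = .tick (.point (rename f h P)) := by
  simp only [Choice.point, rename]

@[simp] theorem rename_timeout_point (f : S → S') (h : A → A') (P Q : Proc S A) (chn : Chn) :
    rename f h (.timeout chn (.point P) (.point Q)) =
      .timeout chn (.point (rename f h P)) (.point (rename f h Q)) := by
  simp only [Choice.point, rename]

@[simp] theorem rename_read_point (f : S → S') (h : A → A') (P : Proc S A) (x : ℕ) (s : S) :
    rename f h (.read x s (.point P)) = .read x (f s) (.point (rename f h P)) := by
  simp only [Choice.point, rename]

@[simp] theorem rename_write_point (f : S → S') (h : A → A') (P : Proc S A) (e : Expr) (a : A) :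
    rename f h (.write e a (.point P)) = .write e (h a) (.point (rename f h P)) := by
  simp only [Choice.point, rename]

@[simp] theorem _root_.CPSCalc.Choice.sem_point {T : Type} (P : T) :
    (Choice.point P).sem = PMF.pure P := by
  simp [Choice.sem, Choice.point, PMF.pure_map]

@[simp] theorem parDist_pure (P Q : Proc S A) :
    parDist (PMF.pure P) (PMF.pure Q) = PMF.pure (.par P Q) := by
  simp [parDist, PMF.pure_map, PMF.pure_bind]

@[simp] theorem resDist_pure (P : Proc S A) (c : ℕ) :
    resDist (PMF.pure P) c = PMF.pure (.res P c) := by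
  simp [resDist, PMF.pure_map]

/-! ## Processes with a single transition -/

/-- The only instantaneous transition of `P` is labelled `l` and leads to `P'`. -/
def OnlyInst (P : Proc S A) (l : Label S A) (P' : Proc S A) : Prop :=
  ∀ l' π, P.Inst l' π ↔ l' = l ∧ π = PMF.pure P'

/-- The only transition of `P` is a `tick` leading to `P'`. -/
def OnlyTick (P P' : Proc S A) : Prop :=
  (∀ l π, ¬ P.Inst l π) ∧ ∀ π, P.Timed π ↔ π = PMF.pure P'

theorem onlyInst_read (x : ℕ) (s : S) (P : Proc S A) :
    OnlyInst (.read x s (.point P)) (.read s x) P := by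
  intro l π
  constructor
  · intro h; cases h; simp
  · rintro ⟨rfl, rfl⟩
    simpa using Inst.read x s (Choice.point P)

theorem onlyInst_write (v : Value) (a : A) (P : Proc S A) :
    OnlyInst (.write (.val v) a (.point P)) (.write a v) P := by
  intro l π
  constructor
  · intro h; cases h; simp
  · rintro ⟨rfl, rfl⟩
    simpa using Inst.write v a (Choice.point P)

theorem onlyTick_sleep (P : Proc S A) : OnlyTick (sleep P) P := by
  refine ⟨fun l π h => (by cases h), fun π => ⟨?_, ?_⟩⟩
  · intro h; cases h; simp
  · rintro rfl
    simpa [sleep] using Timed.delay (Choice.point P)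

theorem inst_fix_iff {X : ℕ} {P : Proc S A} {l : Label S A} {π : PMF (Proc S A)} :
    Inst (.fix X P) l π ↔ Inst (psubst X (.fix X P) P) l π :=
  ⟨fun h => by cases h; assumption, .recur⟩

theorem timed_fix_iff {X : ℕ} {P : Proc S A} {π : PMF (Proc S A)} :
    Timed (.fix X P) π ↔ Timed (psubst X (.fix X P) P) π :=
  ⟨fun h => by cases h; assumption, .recur⟩

theorem inst_ite_pos {b : Guard} (hb : b.Holds) {P Q : Proc S A} {l : Label S A}
    {π : PMF (Proc S A)} : Inst (.ite b P Q) l π ↔ Inst P l π :=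
  ⟨fun h => by cases h <;> first | assumption | contradiction, .ifTrue hb⟩

theorem inst_ite_neg {b : Guard} (hb : ¬ b.Holds) {P Q : Proc S A} {l : Label S A}
    {π : PMF (Proc S A)} : Inst (.ite b P Q) l π ↔ Inst Q l π :=
  ⟨fun h => by cases h <;> first | assumption | contradiction, .ifFalse hb⟩

theorem timed_ite_neg {b : Guard} (hb : ¬ b.Holds) {P Q : Proc S A}
    {π : PMF (Proc S A)} : Timed (.ite b P Q) π ↔ Timed Q π :=
  ⟨fun h => by cases h <;> first | assumption | contradiction, .ifFalse hb⟩

theorem OnlyInst.fix {X : ℕ} {P P' : Proc S A} {l : Label S A}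
    (h : OnlyInst (psubst X (.fix X P) P) l P') : OnlyInst (.fix X P) l P' :=
  fun l' π => inst_fix_iff.trans (h l' π)

theorem OnlyInst.ite_pos {b : Guard} {P Q P' : Proc S A} {l : Label S A} (h : OnlyInst P l P')
    (hb : b.Holds) : OnlyInst (.ite b P Q) l P' :=
  fun l' π => (inst_ite_pos hb).trans (h l' π)

theorem OnlyInst.ite_neg {b : Guard} {P Q P' : Proc S A} {l : Label S A} (h : OnlyInst Q l P')
    (hb : ¬ b.Holds) : OnlyInst (.ite b P Q) l P' :=
  fun l' π => (inst_ite_neg hb).trans (h l' π)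

theorem OnlyTick.fix {X : ℕ} {P P' : Proc S A} (h : OnlyTick (psubst X (.fix X P) P) P') :
    OnlyTick (.fix X P) P' :=
  ⟨fun l π hi => h.1 l π (inst_fix_iff.1 hi), fun π => timed_fix_iff.trans (h.2 π)⟩

theorem OnlyTick.ite_neg {b : Guard} {P Q P' : Proc S A} (h : OnlyTick Q P')
    (hb : ¬ b.Holds) : OnlyTick (.ite b P Q) P' :=
  ⟨fun l π hi => h.1 l π ((inst_ite_neg hb).1 hi), fun π => (timed_ite_neg hb).trans (h.2 π)⟩

end Proc

/-! ## The behaviour of a single engine -/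

section Controller

variable {S A : Type} (s : S) (a : A) (ident : Value)

/-- The measurement after five time units of cooling, followed by `P` if the engine is still hot
and by `write off. tick. Q` otherwise. -/
noncomputable def coolingTest (P Q : Proc S A) : Proc S A :=
  .read 0 s <| .point <| .ite isHot (prefixed 2 (.out warning (.val ident)) P)
    (.write (.val (.real offVal)) a <| .point <| sleep Q)

/-- The cooling loop, where `Q` is to be executed once the engine is cold. -/
noncomputable def coolingLoop (Q : Proc S A) : Proc S A :=
  .fix 1 <| sleeps 5 <| coolingTest s a ident (.pvar 1) Q

/-- The controller for the sensor `s` and the actuator `a`. -/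
noncomputable def controller : Proc S A :=
  .fix 0 <| .read 0 s <| .point <| .ite isHot
    (.write (.val (.real onVal)) a <| .point <| coolingLoop s a ident (.pvar 0))
    (sleep (.pvar 0))

theorem rename_ctrl {S A : Type} (f : EngSensor → S) (h : EngActuator → A) :
    (ctrl ident).rename f h = controller (f .st) (h .cool) ident := by
  simp [ctrl, controller, cooling, coolingLoop, coolingTest, sleeps, sleep, prefixed]

/-- The guard `r > 10`. -/
noncomputable def hotGuard (r : ℝ) : Guard := .lt (.val (.real 10)) (.val (.real r))

theorem hotGuard_holds {r : ℝ} : (hotGuard r).Holds ↔ 10 < r := by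
  simp [hotGuard, Guard.Holds]

/-- `controller` after reading the value `r`. -/
noncomputable def controllerTest (r : ℝ) : Proc S A :=
  .ite (hotGuard r)
    (.write (.val (.real onVal)) a <| .point <| coolingLoop s a ident (controller s a ident))
    (sleep (controller s a ident))

/-- `coolingTest` after reading the value `r`. -/
noncomputable def coolingTested (r : ℝ) : Proc S A :=
  .ite (hotGuard r)
    (prefixed 2 (.out warning (.val ident)) (coolingLoop s a ident (controller s a ident)))
    (.write (.val (.real offVal)) a <| .point <| sleep (controller s a ident))

theorem subst_controller (v : Value) : (controller s a ident).subst 0 v = controller s a ident := by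
  simp [controller]

theorem subst_coolingLoop (v : Value) (Q : Proc S A) :
    (coolingLoop s a ident Q).subst 0 v = coolingLoop s a ident Q := by
  simp [coolingLoop, coolingTest, sleeps, sleep, prefixed, isHot]

theorem psubst_controller (X : ℕ) (R : Proc S A) (hX : X = 0 ∨ X = 1):
    psubst X R (controller s a ident) = controller s a ident := by
  rcases hX with rfl | rfl <;>
    simp [controller, coolingLoop, coolingTest, sleeps, sleep, prefixed]

theorem controller_read : ∃ P : Proc S A, OnlyInst (controller s a ident) (.read s 0) P ∧
    ∀ r, P.subst 0 (.real r) = controllerTest s a ident r := by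
  refine ⟨_, OnlyInst.fix (by rw [psubst_read_point]; exact onlyInst_read _ _ _), ?_⟩
  · intro r
    rw [← controller]
    simp [controllerTest, coolingLoop, coolingTest, sleeps, sleep, prefixed,
      subst_controller, isHot, hotGuard, Guard.subst, Expr.subst]

theorem coolingLoop_tick : OnlyTick (coolingLoop s a ident (controller s a ident))
    (sleeps 4 (coolingTest s a ident (coolingLoop s a ident (controller s a ident))
      (controller s a ident))) := by
  refine OnlyTick.fix ?_
  rw [← coolingLoop]
  have h := psubst_controller s a ident 1 (coolingLoop s a ident (controller s a ident)) (.inr rfl)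
  simpa [sleeps, sleep, coolingTest, prefixed, h] using onlyTick_sleep _

theorem coolingTest_read : ∃ P : Proc S A,
    OnlyInst (coolingTest s a ident (coolingLoop s a ident (controller s a ident))
      (controller s a ident)) (.read s 0) P ∧
    ∀ r, P.subst 0 (.real r) = coolingTested s a ident r := by
  refine ⟨_, onlyInst_read _ _ _, ?_⟩
  intro r
  simp [coolingTested, sleep, prefixed, subst_controller, subst_coolingLoop,
    isHot, hotGuard, Guard.subst, Expr.subst]

/-- The reachable configurations of an engine: process, temperature, measured temperature and
value of the actuator.  The first index bounds the number of instantaneous transitions before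
the next `tick`. -/
inductive EngineInv : ℕ → Proc S A → ℝ → ℝ → ℝ → Prop
  | start {t y u : ℝ} : 0 ≤ u → 0 ≤ t → t ≤ 11.5 → |y - t| ≤ 0.1 →
      EngineInv 2 (controller s a ident) t y u
  | test {t y u : ℝ} : 0 ≤ u → 0 ≤ t → t ≤ 11.5 → |y - t| ≤ 0.1 →
      EngineInv 1 (controllerTest s a ident y) t y u
  | cool {t y u : ℝ} : u < 0 → 9.9 ≤ t → t ≤ 11.5 →
      EngineInv 0 (coolingLoop s a ident (controller s a ident)) t y u
  | cooling {k : ℕ} {t y u : ℝ} : k ≤ 4 → u < 0 → 2.9 + 1.4 * k ≤ t → t ≤ 9.5 + 0.4 * k →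
      |y - t| ≤ 0.1 →
      EngineInv 2 (sleeps k (coolingTest s a ident (coolingLoop s a ident (controller s a ident))
        (controller s a ident))) t y u
  | cooled {t y u : ℝ} : 2.9 ≤ t → t ≤ 9.5 → |y - t| ≤ 0.1 →
      EngineInv 1 (coolingTested s a ident y) t y u
  | off {t y u : ℝ} : 0 ≤ u → 2.9 ≤ t → t ≤ 9.5 →
      EngineInv 0 (sleep (controller s a ident)) t y u

variable {s a ident}

theorem EngineInv.temp_mem {n : ℕ} {P : Proc S A} {t y u : ℝ}
    (h : EngineInv s a ident n P t y u) : 0 ≤ t ∧ t ≤ 30 := by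
  cases h with
  | @cooling k _ _ _ hk _ h1 h2 =>
    have h3 : (k : ℝ) ≤ 4 := by exact_mod_cast hk
    have h4 := Nat.cast_nonneg (α := ℝ) k
    constructor <;> linarith
  | _ => constructor <;> linarith

theorem EngineInv.subst_eq {n : ℕ} {P : Proc S A} {t y u : ℝ}
    (h : EngineInv s a ident n P t y u) (v : Value) : P.subst 0 v = P := by
  have sleeps_eq (k : ℕ) (Q : Proc S A) (hQ : Q.subst 0 v = Q) :
      (sleeps k Q).subst 0 v = sleeps k Q := by
    induction k with
    | zero => exact hQ
    | succ k ih => simp [sleeps, sleep, ih]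
  cases h with
  | cooling => exact sleeps_eq _ _ (by simp [coolingTest])
  | _ =>
    simp [controllerTest, coolingTested, hotGuard, sleep, prefixed, subst_controller,
      subst_coolingLoop, Guard.subst, Expr.subst]

/-- Temperatures and measurements that are possible one time unit after temperature `t`, if the
actuator has value `u`. -/
structure Evolves (t u t' y' : ℝ) : Prop where
  off : 0 ≤ u → t + 0.6 ≤ t' ∧ t' ≤ t + 1.4
  on : u < 0 → t - 1.4 ≤ t' ∧ t' ≤ t - 0.4
  meas : |y' - t'| ≤ 0.1

theorem EngineInv.step {n : ℕ} {P : Proc S A} {t y u : ℝ} (h : EngineInv s a ident n P t y u) :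
    (∃ P', OnlyInst P (.read s 0) P' ∧
      ∃ m < n, EngineInv s a ident m (P'.subst 0 (.real y)) t y u) ∨
    (∃ v P', OnlyInst P (.write a (.real v)) P' ∧ ∃ m < n, EngineInv s a ident m P' t y v) ∨
    (∃ P', OnlyTick P P' ∧ ∀ t' y', Evolves t u t' y' →
      ∃ m, EngineInv s a ident m P' t' y' u) := by
  cases h with
  | start hu h0 h1 hy =>
    obtain ⟨P, hP, hs⟩ := controller_read s a ident
    exact .inl ⟨P, hP, 1, by norm_num, hs y ▸ .test hu h0 h1 hy⟩
  | test hu h0 h1 hy =>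
    obtain ⟨hy1, hy2⟩ := abs_le.1 hy
    by_cases hh : 10 < y
    · exact .inr <| .inl ⟨onVal, _, (onlyInst_write _ _ _).ite_pos (hotGuard_holds.2 hh), 0,
        by norm_num, .cool (by norm_num [onVal]) (by linarith) h1⟩
    · refine .inr <| .inr ⟨_, (onlyTick_sleep _).ite_neg (mt hotGuard_holds.1 hh), ?_⟩
      intro t' y' ht
      have := ht.off hu
      exact ⟨2, .start hu (by linarith) (by linarith) ht.meas⟩
  | cool hu h0 h1 =>
    refine .inr <| .inr ⟨_, coolingLoop_tick _ _ _, fun t' y' ht => ⟨2, ?_⟩⟩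
    have := ht.on hu
    exact .cooling le_rfl hu (by push_cast; linarith) (by push_cast; linarith) ht.meas
  | @cooling k _ _ _ hk hu h0 h1 hy =>
    cases k with
    | zero =>
      obtain ⟨P, hP, hs⟩ := coolingTest_read s a ident
      push_cast at h0 h1
      exact .inl ⟨P, hP, 1, by norm_num, hs y ▸ .cooled (by linarith) (by linarith) hy⟩
    | succ k =>
      refine .inr <| .inr ⟨_, onlyTick_sleep _, fun t' y' ht => ⟨2, ?_⟩⟩
      have := ht.on hu
      push_cast at h0 h1
      exact .cooling (by omega) hu (by linarith) (by linarith) ht.meas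
  | cooled h0 h1 hy =>
    obtain ⟨hy1, hy2⟩ := abs_le.1 hy
    exact .inr <| .inl ⟨offVal, _, (onlyInst_write _ _ _).ite_neg
      (mt hotGuard_holds.1 (by linarith)), 0, by norm_num, .off (by norm_num [offVal]) h0 h1⟩
  | off hu h0 h1 =>
    refine .inr <| .inr ⟨_, onlyTick_sleep _, fun t' y' ht => ⟨2, ?_⟩⟩
    have := ht.off hu
    exact .start hu (by linarith) (by linarith) ht.meas

end Controller

/-! ## The behaviour of the airplane -/

section Check

variable {S A : Type}

theorem check_inst {l : Label S A} {π : PMF (Proc S A)} (h : check.Inst l π) :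
    ∃ v, l = .inp warning v := by
  rw [check, inst_fix_iff, psubst_timeout_point] at h
  cases h
  exact ⟨_, rfl⟩

theorem check_timed {π : PMF (Proc S A)} : check.Timed π ↔ π = PMF.pure check := by
  rw [check, timed_fix_iff, psubst_timeout_point, psubst_pvar, if_pos rfl]
  constructor
  · intro h; cases h; simp
  · rintro rfl
    simpa using Timed.timeout _ (Choice.point _) (Choice.point _)

/-- The process of an airplane without pending warnings, with the given processes of the left and
the right engine. -/
noncomputable def airplaneProc (P Q : Proc S A) : Proc S A :=
  .res (.par (.par P Q) check) warning

/-- No communication takes place: the labels of `P` are actuator writes and sensor reads. -/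
def Local (P : Proc S A) : Prop :=
  ∀ l π, P.Inst l π → (∃ a v, l = .write a v) ∨ ∃ s x, l = .read s x

theorem Proc.OnlyInst.local_write {P P' : Proc S A} {a : A} {v : Value}
    (h : OnlyInst P (.write a v) P') : Local P :=
  fun l π hl => .inl ⟨a, v, ((h l π).1 hl).1⟩

theorem Proc.OnlyInst.local_read {P P' : Proc S A} {s : S} {x : ℕ}
    (h : OnlyInst P (.read s x) P') : Local P :=
  fun l π hl => .inr ⟨s, x, ((h l π).1 hl).1⟩

theorem Proc.OnlyTick.local {P P' : Proc S A} (h : OnlyTick P P') : Local P :=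
  fun l π hl => (h.1 l π hl).elim

theorem Local.par_inst {P Q : Proc S A} (hP : Local P) {l : Label S A}
    {π : PMF (Proc S A)} (h : (Proc.par P Q).Inst l π) :
    (∃ π', P.Inst l π' ∧ π = parDist π' (PMF.pure Q)) ∨
    (∃ π', Q.Inst l π' ∧ π = parDist (PMF.pure P) π') := by
  cases h with
  | comL h1 h2 => simpa using hP _ _ h1
  | comR h1 h2 => simpa using hP _ _ h1
  | parL h => exact .inl ⟨_, h, rfl⟩
  | parR h => exact .inr ⟨_, h, rfl⟩

theorem Local.par {P Q : Proc S A} (hP : Local P) (hQ : Local Q) : Local (.par P Q) := by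
  intro l π h
  rcases hP.par_inst h with ⟨_, h, _⟩ | ⟨_, h, _⟩
  exacts [hP _ _ h, hQ _ _ h]

/-- The transitions of `airplaneProc P Q` are those of `P` and `Q`. -/
theorem Local.airplaneProc_inst {P Q : Proc S A} (hP : Local P) (hQ : Local Q) {l : Label S A}
    {π : PMF (Proc S A)} (h : (airplaneProc P Q).Inst l π) :
    (∃ π', P.Inst l π' ∧ π = π'.map fun P' => airplaneProc P' Q) ∨
    (∃ π', Q.Inst l π' ∧ π = π'.map fun Q' => airplaneProc P Q') := by
  have hPQ := hP.par hQ
  cases h with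
  | chnRes h hl =>
    cases h with
    | comL h1 h2 => simpa using hPQ _ _ h1
    | comR h1 h2 => simpa using hPQ _ _ h1
    | parL h' =>
      rcases hP.par_inst h' with ⟨π', h, rfl⟩ | ⟨π', h, rfl⟩
      · refine .inl ⟨π', h, ?_⟩
        simp [resDist, parDist, PMF.map, airplaneProc, Function.comp_def]
      · refine .inr ⟨π', h, ?_⟩
        simp [resDist, parDist, PMF.map, airplaneProc, Function.comp_def]
    | parR h =>
      obtain ⟨v, rfl⟩ := check_inst h
      exact absurd rfl (hl v).1

theorem airplaneProc_inst_left {P P' Q : Proc S A} {l : Label S A}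
    (hl : ∀ v, l ≠ .inp warning v ∧ l ≠ .out warning v) (h : P.Inst l (PMF.pure P')) :
    (airplaneProc P Q).Inst l (PMF.pure (airplaneProc P' Q)) := by
  simpa [airplaneProc] using Inst.chnRes (h.parL (Q := Q)).parL hl

theorem airplaneProc_inst_right {P Q Q' : Proc S A} {l : Label S A}
    (hl : ∀ v, l ≠ .inp warning v ∧ l ≠ .out warning v) (h : Q.Inst l (PMF.pure Q')) :
    (airplaneProc P Q).Inst l (PMF.pure (airplaneProc P Q')) := by
  simpa [airplaneProc] using Inst.chnRes (h.parR (P := P)).parL hl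

theorem airplaneProc_timed {P P' Q Q' : Proc S A} (hP : OnlyTick P P') (hQ : OnlyTick Q Q')
    {π : PMF (Proc S A)} :
    (airplaneProc P Q).Timed π ↔ π = PMF.pure (airplaneProc P' Q') := by
  have hPQ : ∀ l π, ¬ (Proc.par P Q).Inst l π := by
    intro l π h
    rcases hP.local.par_inst h with ⟨_, h, _⟩ | ⟨_, h, _⟩
    exacts [hP.1 _ _ h, hQ.1 _ _ h]
  constructor
  · intro h
    cases h with
    | chnRes h =>
      cases h with
      | timePar h hc _ =>
        cases h with
        | timePar h1 h2 _ =>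
          rw [(hP.2 _).1 h1, (hQ.2 _).1 h2, check_timed.1 hc]
          simp [airplaneProc]
  · rintro rfl
    have h := Timed.timePar ((hP.2 _).2 rfl) ((hQ.2 _).2 rfl) fun ⟨π, h⟩ => hPQ _ _ h
    have h' := Timed.timePar h (check_timed.2 rfl) (by
      rintro ⟨π, h⟩
      cases h with
      | comL h _ => exact hPQ _ _ h
      | comR h _ => exact hPQ _ _ h
      | parL h => exact hPQ _ _ h
      | parR h => obtain ⟨v, hv⟩ := check_inst h; cases hv)
    simpa [airplaneProc] using Timed.chnRes (c := warning) h'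

end Check

theorem subst_airplaneProc {S A : Type} (P Q : Proc S A) (v : Value) :
    (airplaneProc P Q).subst 0 v = airplaneProc (P.subst 0 v) (Q.subst 0 v) := by
  simp [airplaneProc, check]

/-! ## Physical evolution of the airplane -/

theorem mem_support_unifGrid {g : ℕ} {v w : ℝ} {h : v ≤ w} {k : ℝ}
    (hk : k ∈ (unifGrid g v w h).support) : v ≤ k ∧ k ≤ w := by
  rw [unifGrid, PMF.support_uniformOfFinset] at hk
  simp only [Set.Finite.coe_toFinset] at hk
  exact hk.1

theorem evolves_of_mem_support {g : ℕ} {κ : ℝ} (h1 : 0.8 ≤ κ) (h2 : κ ≤ 1)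
    {x x' : EngVar → ℝ} {a : EngActuator → ℝ} {s' : EngSensor → ℝ}
    (hx : x' ∈ ((engEnv g κ).evol x a).support) (hs : s' ∈ ((engEnv g κ).meas x').support) :
    Evolves (x .temp) (a .cool) (x' .temp) (s' .st) := by
  simp only [engEnv, PMF.support_map, Set.mem_image] at hx hs
  obtain ⟨v, hv, rfl⟩ := hx
  obtain ⟨w, hw, rfl⟩ := hs
  have hv := mem_support_unifGrid hv
  have hw := mem_support_unifGrid hw
  refine ⟨fun hu => ?_, fun hu => ?_, ?_⟩
  · rw [drift, if_pos hu, delta] at hv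
    constructor <;> linarith [hv.1, hv.2]
  · rw [drift, if_neg hu.not_ge, delta] at hv
    constructor <;> linarith [hv.1, hv.2]
  · rw [err] at hw
    simpa [abs_le] using hw

theorem mem_support_sumDist {Y₁ Y₂ : Type} {p : PMF (Y₁ → ℝ)} {q : PMF (Y₂ → ℝ)} {f : Y₁ ⊕ Y₂ → ℝ}
    (h : f ∈ (sumDist p q).support) : f ∘ Sum.inl ∈ p.support ∧ f ∘ Sum.inr ∈ q.support := by
  simp only [sumDist, PMF.support_bind, PMF.support_map, Set.mem_iUnion, Set.mem_image] at h
  obtain ⟨f₁, h₁, f₂, h₂, rfl⟩ := h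
  exact ⟨h₁, h₂⟩

/-- The physical environment of the airplane. -/
noncomputable def airplaneEnv (g : ℕ) (κ : ℝ) :
    PhysEnv (EngVar ⊕ EngVar) (EngSensor ⊕ EngSensor) (EngActuator ⊕ EngActuator) :=
  (engEnv g κ).uplus (engEnv g κ)

theorem evolves_of_mem_support_next {g : ℕ} {κ : ℝ} (h1 : 0.8 ≤ κ) (h2 : κ ≤ 1)
    {σ σ' : PhysState (EngVar ⊕ EngVar) (EngSensor ⊕ EngSensor) (EngActuator ⊕ EngActuator)}
    (h : σ' ∈ ((airplaneEnv g κ).next σ).support) :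
    σ'.a = σ.a ∧
    Evolves (σ.x (.inl .temp)) (σ.a (.inl .cool)) (σ'.x (.inl .temp)) (σ'.s (.inl .st)) ∧
    Evolves (σ.x (.inr .temp)) (σ.a (.inr .cool)) (σ'.x (.inr .temp)) (σ'.s (.inr .st)) := by
  simp only [PhysEnv.next, PMF.support_bind, PMF.support_map, Set.mem_iUnion, Set.mem_image] at h
  obtain ⟨x', hx, s', hs, rfl⟩ := h
  have hx := mem_support_sumDist hx
  have hs := mem_support_sumDist hs
  exact ⟨rfl, evolves_of_mem_support h1 h2 hx.1 hs.1, evolves_of_mem_support h1 h2 hx.2 hs.2⟩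

namespace CPS

variable {X S A : Type}

@[simp] theorem confDist_pure (E : PhysEnv X S A) (ς : PMF (PhysState X S A)) (P : Proc S A) :
    confDist E ς (PMF.pure P) = ς.map fun σ => .conf E σ P := by
  simp [confDist, PMF.map, Function.comp_def]

/-! ## Weak transitions and bisimulation -/

theorem liftTrans_pure {M : CPS X S A} {α : Act} {γ : PMF (CPS X S A)} (h : HatTrans M α γ) :
    LiftTrans α (PMF.pure M) γ := by
  refine ⟨1, fun _ => 1, fun _ => M, Finset.univ, fun _ => γ, ?_⟩
  simp only [Finset.univ_unique, Finset.sum_singleton, one_mul]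
  simp [h]

/-- `M` can perform a `tick` after finitely many deterministic `τ`-transitions, and all systems
reached by the `tick` satisfy `G`. -/
inductive CanTick (G : CPS X S A → Prop) : CPS X S A → Prop
  | tick {M : CPS X S A} {γ : PMF (CPS X S A)} : Trans M .tick γ → (∀ N ∈ γ.support, G N) →
      CanTick G M
  | tau {M M' : CPS X S A} : Trans M .tau (PMF.pure M') → CanTick G M' → CanTick G M

theorem CanTick.weak {G : CPS X S A → Prop} {M : CPS X S A} (h : CanTick G M) :
    ∃ γ : PMF (CPS X S A), Weak .tick (PMF.pure M) γ ∧ ∀ N ∈ γ.support, G N := by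
  induction h with
  | tick h hG => exact ⟨_, .inr ⟨by simp, _, _, .refl, liftTrans_pure (.inl h), .refl⟩, hG⟩
  | tau h _ ih =>
    obtain ⟨γ, hw, hG⟩ := ih
    rcases hw with ⟨h0, _⟩ | ⟨h0, γ₁, γ₂, w1, w2, w3⟩
    · cases h0
    · exact ⟨γ, .inr ⟨h0, γ₁, γ₂, .head (liftTrans_pure (.inl h)) w1, w2, w3⟩, hG⟩

theorem exists_matching (γ γ' : PMF (CPS X S A)) :
    ∃ ω, IsMatching ω γ γ' ∧ ∀ M N, 0 < ω (M, N) → M ∈ γ.support ∧ N ∈ γ'.support := by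
  classical
  have key : ∀ M N, (γ.bind fun M => γ'.map fun N => (M, N)) (M, N) = γ M * γ' N := by
    intro M N
    rw [PMF.bind_apply, tsum_eq_single M]
    · congr 1
      rw [PMF.map_apply, tsum_eq_single N]
      · simp
      · intro N' h; simp [h.symm]
    · intro M' h
      simp [PMF.map_apply, h.symm]
  refine ⟨γ.bind fun M => γ'.map fun N => (M, N), ⟨fun M => ?_, fun N => ?_⟩, fun M N h => ?_⟩
  · simp only [key, ENNReal.tsum_mul_left, PMF.tsum_coe, mul_one]
  · simp only [key, ENNReal.tsum_mul_right, PMF.tsum_coe, one_mul]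
  · rw [key] at h
    exact mul_ne_zero_iff.1 h.ne'

/-- Systems that perform `τ`-transitions and `tick`s forever, are never prevented from performing
another `tick`, and never perform anything else are bisimilar. -/
theorem bisimilar_of_canTick (G : CPS X S A → Prop)
    (hG : ∀ M, G M → ∀ α γ, Trans M α γ → (α = .tau ∨ α = .tick) ∧ ∀ N ∈ γ.support, G N)
    (ht : ∀ M, G M → CanTick G M) {M N : CPS X S A} (hM : G M) (hN : G N) : Bisimilar M N := by
  refine ⟨fun M N => G M ∧ G N, ⟨fun _ _ h => h.symm, ?_⟩, hM, hN⟩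
  rintro M N ⟨hM, hN⟩ α γ h
  obtain ⟨hα, hγ⟩ := hG M hM α γ h
  obtain ⟨γ', hw, hγ'⟩ : ∃ γ' : PMF (CPS X S A), Weak α (PMF.pure N) γ' ∧
      ∀ N ∈ γ'.support, G N := by
    rcases hα with rfl | rfl
    · exact ⟨PMF.pure N, .inl ⟨rfl, .refl⟩, by simpa using hN⟩
    · exact (ht N hN).weak
  obtain ⟨ω, hω, hs⟩ := exists_matching γ γ'
  exact ⟨γ', ω, hω, hw, fun M' N' h => ⟨hγ _ (hs _ _ h).1, hγ' _ (hs _ _ h).2⟩⟩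

end CPS

/-! ## The invariant of the airplane -/

/-- The reachable configurations of an airplane whose engines have some cooling power between
`0.8` and `1`.  The first index bounds the number of instantaneous transitions before the next
`tick`. -/
inductive AirplaneInv (g : ℕ) :
    ℕ → CPS (EngVar ⊕ EngVar) (EngSensor ⊕ EngSensor) (EngActuator ⊕ EngActuator) → Prop
  | intro {κ : ℝ} (σ) {m n : ℕ} {P Q} : 0.8 ≤ κ → κ ≤ 1 →
      EngineInv (.inl .st) (.inl .cool) idL m P
        (σ.x (.inl .temp)) (σ.s (.inl .st)) (σ.a (.inl .cool)) →
      EngineInv (.inr .st) (.inr .cool) idR n Q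
        (σ.x (.inr .temp)) (σ.s (.inr .st)) (σ.a (.inr .cool)) →
      AirplaneInv g (m + n) (.conf (airplaneEnv g κ) σ (airplaneProc P Q))

theorem EngineInv.local {S A : Type} {s : S} {a : A} {ident : Value} {n : ℕ} {P : Proc S A}
    {t y u : ℝ} (h : EngineInv s a ident n P t y u) : Local P := by
  rcases h.step with ⟨_, h, _⟩ | ⟨_, _, h, _⟩ | ⟨_, h, _⟩
  exacts [h.local_read, h.local_write, h.local]

theorem EngineInv.of_read {S A : Type} {s s' : S} {a : A} {ident : Value} {n z : ℕ} {P : Proc S A}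
    {t y u : ℝ} (h : EngineInv s a ident n P t y u) {π : PMF (Proc S A)}
    (hi : P.Inst (.read s' z) π) : s' = s ∧ z = 0 ∧ ∃ P', π = PMF.pure P' ∧
      ∃ m, EngineInv s a ident m (P'.subst 0 (.real y)) t y u := by
  rcases h.step with ⟨P', h, m, _, hm⟩ | ⟨_, _, h, _⟩ | ⟨_, h, _⟩
  · obtain ⟨h1, h2⟩ := (h _ _).1 hi
    cases h1
    exact ⟨rfl, rfl, P', h2, m, hm⟩
  · cases ((h _ _).1 hi).1
  · exact (h.1 _ _ hi).elim

theorem EngineInv.of_write {S A : Type} {s : S} {a a' : A} {ident : Value} {n : ℕ} {P : Proc S A}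
    {t y u v : ℝ} (h : EngineInv s a ident n P t y u) {π : PMF (Proc S A)}
    (hi : P.Inst (.write a' (.real v)) π) : a' = a ∧ ∃ P', π = PMF.pure P' ∧
      ∃ m, EngineInv s a ident m P' t y v := by
  rcases h.step with ⟨_, h, _⟩ | ⟨w, P', h, m, _, hm⟩ | ⟨_, h, _⟩
  · cases ((h _ _).1 hi).1
  · obtain ⟨h1, h2⟩ := (h _ _).1 hi
    cases h1
    exact ⟨rfl, P', h2, m, hm⟩
  · exact (h.1 _ _ hi).elim

section AirplaneInv

variable {g : ℕ} {M : CPS (EngVar ⊕ EngVar) (EngSensor ⊕ EngSensor) (EngActuator ⊕ EngActuator)}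

theorem AirplaneInv.of_inst {n : ℕ} (h : AirplaneInv g n M) {α : Act} {γ : PMF (CPS _ _ _)}
    (hi : CPS.Inst M α γ) : α = .tau ∧ ∀ N ∈ γ.support, ∃ m, AirplaneInv g m N := by
  obtain ⟨σ, h1, h2, hP, hQ⟩ := h
  cases hi with
  | out hi _ =>
    rcases hP.local.airplaneProc_inst hQ.local hi with ⟨_, h, _⟩ | ⟨_, h, _⟩
    · simpa using hP.local _ _ h
    · simpa using hQ.local _ _ h
  | inp hi _ =>
    rcases hP.local.airplaneProc_inst hQ.local hi with ⟨_, h, _⟩ | ⟨_, h, _⟩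
    · simpa using hP.local _ _ h
    · simpa using hQ.local _ _ h
  | tau hi _ =>
    rcases hP.local.airplaneProc_inst hQ.local hi with ⟨_, h, _⟩ | ⟨_, h, _⟩
    · simpa using hP.local _ _ h
    · simpa using hQ.local _ _ h
  | sensRead hi _ =>
    refine ⟨rfl, ?_⟩
    rcases hP.local.airplaneProc_inst hQ.local hi with ⟨_, h, rfl⟩ | ⟨_, h, rfl⟩
    · obtain ⟨rfl, rfl, P', rfl, m, hm⟩ := hP.of_read h
      simp only [PMF.pure_map, CPS.confDist_pure, PMF.support_pure, Set.mem_singleton_iff,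
        forall_eq, subst_airplaneProc, hQ.subst_eq]
      exact ⟨_, .intro σ h1 h2 hm hQ⟩
    · obtain ⟨rfl, rfl, P', rfl, m, hm⟩ := hQ.of_read h
      simp only [PMF.pure_map, CPS.confDist_pure, PMF.support_pure, Set.mem_singleton_iff,
        forall_eq, subst_airplaneProc, hP.subst_eq]
      exact ⟨_, .intro σ h1 h2 hP hm⟩
  | actWrite hi _ =>
    refine ⟨rfl, ?_⟩
    rcases hP.local.airplaneProc_inst hQ.local hi with ⟨_, h, rfl⟩ | ⟨_, h, rfl⟩
    · obtain ⟨rfl, P', rfl, m, hm⟩ := hP.of_write h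
      simp only [PMF.pure_map, CPS.confDist_pure, PMF.support_pure, Set.mem_singleton_iff,
        forall_eq]
      exact ⟨_, .intro _ h1 h2 (by simpa [PhysState.setAct] using hm)
        (by simpa [PhysState.setAct] using hQ)⟩
    · obtain ⟨rfl, P', rfl, m, hm⟩ := hQ.of_write h
      simp only [PMF.pure_map, CPS.confDist_pure, PMF.support_pure, Set.mem_singleton_iff,
        forall_eq]
      exact ⟨_, .intro _ h1 h2 (by simpa [PhysState.setAct] using hP)
        (by simpa [PhysState.setAct] using hm)⟩
  | deadlock hi => exact (hi ⟨hP.temp_mem, hQ.temp_mem⟩).elim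

/-- Either the airplane performs a deterministic `τ`-transition that decreases the index, or time
passes. -/
theorem AirplaneInv.tau_or_tick {n : ℕ} (h : AirplaneInv g n M) :
    (∃ m < n, ∃ M', CPS.Inst M .tau (PMF.pure M') ∧ AirplaneInv g m M') ∨
    ((∃ γ, CPS.Trans M .tick γ) ∧
      ∀ γ, CPS.Trans M .tick γ → ∀ N ∈ γ.support, ∃ m, AirplaneInv g m N) := by
  obtain ⟨σ, h1, h2, hP, hQ⟩ := h
  rename_i κ m n P Q
  have hσ : σ.x ∈ (airplaneEnv g κ).inv := ⟨hP.temp_mem, hQ.temp_mem⟩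
  rcases hP.step with ⟨P', hs, k, hk, hm⟩ | ⟨v, P', hs, k, hk, hm⟩ | ⟨P', hPs, hPm⟩
  · refine .inl ⟨k + n, by omega, _, ?_, .intro σ h1 h2 hm hQ⟩
    simpa [PMF.pure_map, subst_airplaneProc, hQ.subst_eq] using
      CPS.Inst.sensRead (airplaneProc_inst_left (Q := Q) (by simp) ((hs _ _).2 ⟨rfl, rfl⟩)) hσ
  · refine .inl ⟨k + n, by omega, _, ?_, .intro (σ.setAct (.inl .cool) v) h1 h2
      (by simpa [PhysState.setAct] using hm) (by simpa [PhysState.setAct] using hQ)⟩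
    simpa [PMF.pure_map] using
      CPS.Inst.actWrite (airplaneProc_inst_left (Q := Q) (by simp) ((hs _ _).2 ⟨rfl, rfl⟩)) hσ
  rcases hQ.step with ⟨Q', hs, k, hk, hm⟩ | ⟨v, Q', hs, k, hk, hm⟩ | ⟨Q', hQs, hQm⟩
  · refine .inl ⟨m + k, by omega, _, ?_, .intro σ h1 h2 hP hm⟩
    simpa [PMF.pure_map, subst_airplaneProc, hP.subst_eq] using
      CPS.Inst.sensRead (airplaneProc_inst_right (P := P) (by simp) ((hs _ _).2 ⟨rfl, rfl⟩)) hσ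
  · refine .inl ⟨m + k, by omega, _, ?_, .intro (σ.setAct (.inr .cool) v) h1 h2
      (by simpa [PhysState.setAct] using hP) (by simpa [PhysState.setAct] using hm)⟩
    simpa [PMF.pure_map] using
      CPS.Inst.actWrite (airplaneProc_inst_right (P := P) (by simp) ((hs _ _).2 ⟨rfl, rfl⟩)) hσ
  have hno : ∀ l π, ¬ (airplaneProc P Q).Inst l π := by
    intro l π h
    rcases hP.local.airplaneProc_inst hQ.local h with ⟨_, h, _⟩ | ⟨_, h, _⟩
    exacts [hPs.1 _ _ h, hQs.1 _ _ h]
  refine .inr ⟨⟨_, .time ((airplaneProc_timed hPs hQs).2 rfl) ?_ hσ⟩, ?_⟩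
  · rintro ⟨γ, h⟩
    cases h with
    | tau h _ => exact hno _ _ h
    | sensRead h _ => exact hno _ _ h
    | actWrite h _ => exact hno _ _ h
    | deadlock h => exact h hσ
  · intro γ h N hN
    cases h with
    | inst h => cases (AirplaneInv.of_inst (.intro σ h1 h2 hP hQ) h).1
    | time ht _ _ =>
      obtain rfl := (airplaneProc_timed hPs hQs).1 ht
      simp only [CPS.confDist_pure, PMF.support_map, Set.mem_image] at hN
      obtain ⟨σ', hσ', rfl⟩ := hN
      obtain ⟨ha, hl, hr⟩ := evolves_of_mem_support_next h1 h2 hσ'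
      obtain ⟨k, hk⟩ := hPm _ _ hl
      obtain ⟨k', hk'⟩ := hQm _ _ hr
      exact ⟨_, .intro σ' h1 h2 (ha ▸ hk) (ha ▸ hk')⟩

theorem AirplaneInv.of_trans {n : ℕ} (h : AirplaneInv g n M) {α : Act} {γ : PMF (CPS _ _ _)}
    (hi : CPS.Trans M α γ) :
    (α = .tau ∨ α = .tick) ∧ ∀ N ∈ γ.support, ∃ m, AirplaneInv g m N := by
  cases hi with
  | inst hi => exact (h.of_inst hi).imp_left .inl
  | time ht hn hx =>
    rcases h.tau_or_tick with ⟨_, _, M', hM', _⟩ | ⟨_, h⟩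
    · exact (hn ⟨_, hM'⟩).elim
    · exact ⟨.inr rfl, h _ (.time ht hn hx)⟩

theorem AirplaneInv.canTick {n : ℕ} (h : AirplaneInv g n M) :
    CPS.CanTick (fun N => ∃ m, AirplaneInv g m N) M := by
  induction n using Nat.strong_induction_on generalizing M with
  | _ n ih =>
    rcases h.tau_or_tick with ⟨m, hm, M', hM', hI⟩ | ⟨⟨γ, hγ⟩, h⟩
    · exact .tau (.inst hM') (ih m hm hI)
    · exact .tick hγ (h γ hγ)

theorem airplaneWith_inv (g : ℕ) {κ : ℝ} (h1 : 0.8 ≤ κ) (h2 : κ ≤ 1) :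
    AirplaneInv g 4 (airplaneWith g κ) := by
  have h := AirplaneInv.intro (g := g) (engState.uplus engState) h1 h2
    (.start (by norm_num [engState, PhysState.uplus, offVal])
      (by norm_num [engState, PhysState.uplus]) (by norm_num [engState, PhysState.uplus])
      (by norm_num [engState, PhysState.uplus]))
    (.start (by norm_num [engState, PhysState.uplus, offVal])
      (by norm_num [engState, PhysState.uplus]) (by norm_num [engState, PhysState.uplus])
      (by norm_num [engState, PhysState.uplus]))
  simpa only [airplaneWith, engine, CPS.uplus, CPS.par, CPS.res, rename_ctrl, airplaneProc,
    airplaneEnv] using h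

end AirplaneInv

end CPSCalc

theorem mainTheorem12 (g : ℕ) (hg : 0 < g) :
    CPSCalc.CPS.Bisimilar (CPSCalc.airplane g) (CPSCalc.airplaneTilde g) :=
  CPSCalc.CPS.bisimilar_of_canTick (fun M => ∃ n, CPSCalc.AirplaneInv g n M)
    (fun _ h _ _ hi => h.elim fun _ h => h.of_trans hi)
    (fun _ h => h.elim fun _ h => h.canTick)
    ⟨_, CPSCalc.airplaneWith_inv g (by norm_num) le_rfl⟩
    ⟨_, CPSCalc.airplaneWith_inv g le_rfl (by norm_num)⟩
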